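/- Let $d\ge 1$, let $\Omega\subset\mathbb{R}^d$ be a bounded open set (in particular, a bounded Lipschitz polytopal domain with $d\in\{1,2,3\}$), let $T>0$, and let $c\in L^\infty(\Omega)$ satisfy $c(x)\ge c_0>0$ for almost every $x\in\Omega$. Then there are constants $C_\Omega>0$ for which the Poincaré inequality $\|v\|_{L^2(\Omega)}\le C_\Omega\|\nabla v\|_{L^2(\Omega)}$ holds for all $v\in H^1_0(\Omega)$; let $C_\Omega$ be any such constant. Let $S_{h_x}\subset H^1_0(\Omega)$ and $S_{h_t}\subset\{w\in H^1(0,T): w(0)=0\}$ be arbitrary finite-dimensional subspaces, and put $Q_h=S_{h_x}\otimes S_{h_t}$ and $\partial_tQ_h=S_{h_x}\otimes\partial_tS_{h_t}$. Write $$(f,g)_e=\int_0^T (f(\cdot,s),g(\cdot,s))_{L^2(\Omega)}\,e^{-s/T}\,ds,\qquad \|f\|_e^2=(f,f)_e ,$$ and let $$\mathcal A((U,V),(\lambda,\chi))=(\partial_tV,\lambda)_e+(c^2\nabla_xU,\nabla_x\lambda)_e-(\partial_tU,\chi)_e+(V,\chi)_e .$$ For $f\in L^2(\Omega)$ let $N_hf\in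 S_{h_x}$ be the discrete Newton potential, i.e. the solution of $(c^2\nabla N_hf,\nabla v)_{L^2(\Omega)}=(f,v)_{L^2(\Omega)}$ for all $v\in S_{h_x}$, and let $\|f\|_{N_h,e}^2=\int_0^T\|c\nabla N_hf(\cdot,s)\|_{L^2(\Omega)}^2e^{-s/T}\,ds$ for functions $f$ of space and time. Define $$\|(U,V)\|_{\mathcal V_h}^2=\|\partial_tU\|_e^2+\|\partial_tV\|_{N_h,e}^2+\|c\nabla_xU\|_e^2+\|V\|_e^2,\qquad \|(\lambda,\chi)\|_{\mathcal W_h}^2=\|\lambda\|_e^2+\|\chi\|_{N_h,e}^2 .$$ Then for every $(U_h,V_h)\in Q_h\times Q_h$ with $(U_h,V_h)\neq(0,0)$ there exists $(\lambda_h,\chi_h)\in\partial_tQ_h\times\partial_tQ_h$ such that $\|(U_h,V_h)\|_{\mathcal V_h}>0$, $\|(\lambda_h,\chi_h)\|_{\mathcal W_h}>0$ and $$\frac{\mathcal A((U_h,V_h),(\lambda_h,\chi_h))}{\|(U_h,V_h)\|_{\mathcal V_h}\,\|(\lambda_h,\chi_h)\|_{\mathcal W_h}}\ \ge\ \frac{1}{2\sqrt{C_\Omega^2/c_0^2+4T^2}}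 .$$ The constant on the right does not depend on the choice of $S_{h_x}$ and $S_{h_t}$ (unconditional stability). -/

import Mathlib

open MeasureTheory Set Filter
open scoped ENNReal ContDiff

noncomputable section

namespace WaveInfSup

/-- The Euclidean space `ℝ^d`. -/
abbrev E (d : ℕ) : Type := EuclideanSpace ℝ (Fin d)

/-- `L²(Ω)`. -/
abbrev L2 {d : ℕ} (Ω : Set (E d)) : Type := Lp ℝ 2 (volume.restrict Ω)

/-- `L²(Ω; ℝ^d)`. -/
abbrev L2vec {d : ℕ} (Ω : Set (E d)) : Type := Lp (E d) 2 (volume.restrict Ω)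

/-- The smooth functions with compact support in `Ω`. -/
structure IsTestFunction {d : ℕ} (Ω : Set (E d)) (φ : E d → ℝ) : Prop where
  smooth : ContDiff ℝ ∞ φ
  compact : HasCompactSupport φ
  support : tsupport φ ⊆ Ω

/-- The pairs `(φ, ∇φ)` with `φ ∈ C_c^∞(Ω)`, as elements of `L²(Ω) × L²(Ω; ℝ^d)`. -/
def testPairs {d : ℕ} (Ω : Set (E d)) : Set (WithLp 2 (L2 Ω × L2vec Ω)) :=
  {p | ∃ φ : E d → ℝ, IsTestFunction Ω φ ∧
    (p.fst : E d → ℝ) =ᵐ[volume.restrict Ω] φ ∧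
    (p.snd : E d → E d) =ᵐ[volume.restrict Ω] gradient φ}

/-- The Sobolev space `H¹₀(Ω)`: the closure of `C_c^∞(Ω)` in the norm
`(‖u‖²_{L²(Ω)} + ‖∇u‖²_{L²(Ω)})^{1/2}`. An element is stored as the pair `(u, ∇u)` of a function
and its weak gradient (see `isWeakGradient_of_mem_H10`), so that it is determined by `u`
(see `H10_ext`). -/
def H10 {d : ℕ} (Ω : Set (E d)) : Submodule ℝ (WithLp 2 (L2 Ω × L2vec Ω)) :=
  (Submodule.span ℝ (testPairs Ω)).topologicalClosure

/-- The function `u ∈ L²(Ω)` underlying an element of `H¹₀(Ω)`. -/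
def fn {d : ℕ} {Ω : Set (E d)} (u : H10 Ω) : L2 Ω := (u : WithLp 2 (L2 Ω × L2vec Ω)).fst

/-- The weak gradient `∇u ∈ L²(Ω; ℝ^d)` of an element of `H¹₀(Ω)`. -/
def grad {d : ℕ} {Ω : Set (E d)} (u : H10 Ω) : L2vec Ω :=
  (u : WithLp 2 (L2 Ω × L2vec Ω)).snd

/-- `g` is the weak gradient of `u` in `Ω`. -/
def IsWeakGradient {d : ℕ} (Ω : Set (E d)) (u : L2 Ω) (g : L2vec Ω) : Prop :=
  ∀ φ : E d → ℝ, IsTestFunction Ω φ → ∀ i : Fin d,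
    ∫ x in Ω, u x * (gradient φ x) i = -∫ x in Ω, (g x) i * φ x

theorem gradient_coord {d : ℕ} (φ : E d → ℝ) (x : E d) (i : Fin d) :
    (gradient φ x) i = fderiv ℝ φ x (EuclideanSpace.single i 1) := by
  have h := inner_gradient_left (𝕜 := ℝ) (f := φ) (x := x) (y := EuclideanSpace.single i (1 : ℝ))
  rw [← h, EuclideanSpace.inner_single_right]
  simp

theorem IsTestFunction.continuous_deriv {d : ℕ} {Ω : Set (E d)} {φ : E d → ℝ}
    (h : IsTestFunction Ω φ) (v : E d) : Continuous fun x => fderiv ℝ φ x v :=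
  (h.smooth.continuous_fderiv (by simp)).clm_apply continuous_const

theorem IsTestFunction.integral_by_parts {d : ℕ} {Ω : Set (E d)} {φ ψ : E d → ℝ}
    (hφ : IsTestFunction Ω φ) (hψ : IsTestFunction Ω ψ) (i : Fin d) :
    ∫ x in Ω, ψ x * (gradient φ x) i = -∫ x in Ω, (gradient ψ x) i * φ x := by
  have hz : ∀ x ∉ Ω, φ x = 0 ∧ ψ x = 0 := fun x hx =>
    ⟨image_eq_zero_of_notMem_tsupport fun h => hx (hφ.support h),
      image_eq_zero_of_notMem_tsupport fun h => hx (hψ.support h)⟩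
  rw [setIntegral_eq_integral_of_forall_compl_eq_zero fun x hx => by simp [(hz x hx).2],
    setIntegral_eq_integral_of_forall_compl_eq_zero fun x hx => by simp [(hz x hx).1]]
  simp only [gradient_coord]
  refine integral_mul_fderiv_eq_neg_fderiv_mul_of_integrable ?_ ?_ ?_
    (fun x _ => hψ.smooth.differentiable (by simp) x)
    (fun x _ => hφ.smooth.differentiable (by simp) x)
  · exact ((hψ.continuous_deriv _).mul hφ.smooth.continuous).integrable_of_hasCompactSupport
      hφ.compact.mul_left
  · exact (hψ.smooth.continuous.mul (hφ.continuous_deriv _)).integrable_of_hasCompactSupport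
      hψ.compact.mul_right
  · exact (hψ.smooth.continuous.mul hφ.smooth.continuous).integrable_of_hasCompactSupport
      hψ.compact.mul_right

theorem isWeakGradient_of_mem_H10 {d : ℕ} {Ω : Set (E d)} (u : H10 Ω) :
    IsWeakGradient Ω (fn u) (grad u) := by
  intro φ hφ i
  have hA : MemLp (fun x => (gradient φ x) i) 2 (volume.restrict Ω) := by
    simp only [gradient_coord]
    exact ((hφ.continuous_deriv _).memLp_of_hasCompactSupport
      (hφ.compact.fderiv_apply (𝕜 := ℝ) _)).restrict Ω
  have hB : MemLp (fun x => φ x • (EuclideanSpace.single i (1 : ℝ) : E d)) 2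
      (volume.restrict Ω) :=
    ((hφ.smooth.continuous.smul continuous_const).memLp_of_hasCompactSupport
      hφ.compact.smul_right).restrict Ω
  let ℓ : WithLp 2 (L2 Ω × L2vec Ω) →L[ℝ] ℝ :=
    (innerSL ℝ hA.toLp).comp (WithLp.fstL 2 ℝ _ _) +
      (innerSL ℝ hB.toLp).comp (WithLp.sndL 2 ℝ _ _)
  have hℓ : ∀ p : WithLp 2 (L2 Ω × L2vec Ω),
      ℓ p = (∫ x in Ω, p.fst x * (gradient φ x) i) + ∫ x in Ω, (p.snd x) i * φ x := by
    intro p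
    have h1 : inner ℝ hA.toLp p.fst = ∫ x in Ω, p.fst x * (gradient φ x) i := by
      rw [MeasureTheory.L2.inner_def]
      refine integral_congr_ae ?_
      filter_upwards [hA.coeFn_toLp] with x hx
      rw [hx]
      simp
    have h2 : inner ℝ hB.toLp p.snd = ∫ x in Ω, (p.snd x) i * φ x := by
      rw [MeasureTheory.L2.inner_def]
      refine integral_congr_ae ?_
      filter_upwards [hB.coeFn_toLp] with x hx
      rw [hx, inner_smul_left, EuclideanSpace.inner_single_left]
      simp [mul_comm]
    rw [← h1, ← h2]
    rfl
  have hle : H10 Ω ≤ LinearMap.ker ℓ.toLinearMap := by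
    refine Submodule.topologicalClosure_minimal _ (Submodule.span_le.2 ?_) ℓ.isClosed_ker
    rintro p ⟨ψ, hψ, h1, h2⟩
    change ℓ p = 0
    have e1 : ∫ x in Ω, p.fst x * (gradient φ x) i = ∫ x in Ω, ψ x * (gradient φ x) i := by
      refine integral_congr_ae ?_
      filter_upwards [h1] with x hx
      rw [hx]
    have e2 : ∫ x in Ω, (p.snd x) i * φ x = ∫ x in Ω, (gradient ψ x) i * φ x := by
      refine integral_congr_ae ?_
      filter_upwards [h2] with x hx
      rw [hx]
    rw [hℓ, e1, e2, hφ.integral_by_parts hψ]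
    simp
  have h0 : ℓ u = 0 := hle u.2
  rw [hℓ] at h0
  exact eq_neg_of_add_eq_zero_left h0

theorem H10_ext {d : ℕ} {Ω : Set (E d)} (hΩ : IsOpen Ω) (u v : H10 Ω)
    (h : fn u = fn v) : u = v := by
  have hi : ∀ i : Fin d, ∀ᵐ x ∂volume, x ∈ Ω → (grad u x) i - (grad v x) i = 0 := by
    intro i
    have hL : ∀ g : L2vec Ω, MemLp (fun x => (g x) i) 2 (volume.restrict Ω) := fun g =>
      (Lp.memLp g).continuousLinearMap_comp (EuclideanSpace.proj i : E d →L[ℝ] ℝ)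
    have hloc : LocallyIntegrable (fun x => (grad u x) i - (grad v x) i) (volume.restrict Ω) :=
      ((hL (grad u)).sub (hL (grad v))).locallyIntegrable (by norm_num)
    refine hΩ.ae_eq_zero_of_integral_contDiff_smul_eq_zero
      (locallyIntegrableOn_of_locallyIntegrable_restrict hloc) ?_
    intro φ h1 h2 h3
    have hφ : IsTestFunction Ω φ := ⟨h1, h2, h3⟩
    have hm : MemLp φ 2 (volume.restrict Ω) :=
      (h1.continuous.memLp_of_hasCompactSupport h2).restrict Ω
    have e1 := isWeakGradient_of_mem_H10 u φ hφ i
    have e2 := isWeakGradient_of_mem_H10 v φ hφ i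
    rw [h, e2] at e1
    rw [← setIntegral_eq_integral_of_forall_compl_eq_zero (s := Ω) fun x hx => by
      simp [image_eq_zero_of_notMem_tsupport fun h => hx (h3 h)]]
    have e3 : ∀ x, φ x • ((grad u x) i - (grad v x) i) =
        (grad u x) i * φ x - (grad v x) i * φ x := fun x => by
      simp only [smul_eq_mul]
      ring
    simp only [e3]
    have i1 : ∀ g : L2vec Ω, Integrable (fun x => (g x) i * φ x) (volume.restrict Ω) :=
      fun g => (hL g).integrable_mul hm
    rw [integral_sub (i1 (grad u)) (i1 (grad v))]
    linarith
  have hg : grad u = grad v := by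
    refine Lp.ext ?_
    have := ae_all_iff.2 hi
    filter_upwards [ae_restrict_of_ae this, ae_restrict_mem hΩ.measurableSet] with x hx hxΩ
    ext i
    exact sub_eq_zero.1 (hx i hxΩ)
  refine Subtype.ext (WithLp.ofLp_injective 2 (Prod.ext h hg))

/-- `C` is a constant in the Poincaré inequality `‖v‖_{L²(Ω)} ≤ C ‖∇v‖_{L²(Ω)}` on `H¹₀(Ω)`. -/
def IsPoincareConstant {d : ℕ} (Ω : Set (E d)) (C : ℝ) : Prop :=
  0 < C ∧ ∀ v : H10 Ω, ‖fn v‖ ≤ C * ‖grad v‖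

/-- The form `(c² ∇u, ∇v)_{L²(Ω)}`; on the diagonal it is `‖c ∇u‖²_{L²(Ω)}`. -/
def energy {d : ℕ} {Ω : Set (E d)} (c : E d → ℝ) (u v : H10 Ω) : ℝ :=
  ∫ x in Ω, c x ^ 2 * inner ℝ (grad u x) (grad v x)

open Classical in
/-- The discrete Newton potential `N_h u ∈ S` of `u ∈ L²(Ω)`: the solution `z ∈ S` of
`(c² ∇z, ∇v)_{L²(Ω)} = (u, v)_{L²(Ω)}` for all `v ∈ S` (it exists and is unique by the
Lax-Milgram lemma). -/
def discreteNewton {d : ℕ} {Ω : Set (E d)} (c : E d → ℝ) (S : Submodule ℝ (H10 Ω)) (u : L2 Ω) :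
    H10 Ω :=
  if h : ∃ z ∈ S, ∀ v ∈ S, energy c z v = inner ℝ u (fn v) then h.choose else 0

/-- `w ∈ H¹(0,T)` with `w(0) = 0`: absolutely continuous on `[0,T]`, with square integrable
derivative, and zero at `0`. Only the values of `w` on `[0,T]` matter. -/
structure MemH1zero (T : ℝ) (w : ℝ → ℝ) : Prop where
  absolutelyContinuous : AbsolutelyContinuousOnInterval w 0 T
  deriv_memLp : MemLp (deriv w) 2 (volume.restrict (Ioo 0 T))
  zero : w 0 = 0

/-- The space `∂_t S` of the derivatives of the elements of `S`. -/
def timeDeriv (S : Submodule ℝ (ℝ → ℝ)) : Submodule ℝ (ℝ → ℝ) :=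
  Submodule.span ℝ (deriv '' (S : Set (ℝ → ℝ)))

/-- The tensor product space `Sx ⊗ St`, spanned by the functions `(x,t) ↦ φ(x) w(t)` with
`φ ∈ Sx`, `w ∈ St`. A function of space and time is viewed as a function of time with values in
`H¹₀(Ω)`. -/
def tensor {d : ℕ} {Ω : Set (E d)} (Sx : Submodule ℝ (H10 Ω)) (St : Submodule ℝ (ℝ → ℝ)) :
    Submodule ℝ (ℝ → H10 Ω) :=
  Submodule.span ℝ {F | ∃ φ ∈ Sx, ∃ w ∈ St, F = fun t => w t • φ}

/-- The weighted time integral `∫₀ᵀ f(s) e^{-s/T} ds`. -/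
def weighted (T : ℝ) (f : ℝ → ℝ) : ℝ :=
  ∫ s in (0 : ℝ)..T, f s * Real.exp (-s / T)

/-- The weighted scalar product `(U, V)_{L²_e(Q_T)} = ∫₀ᵀ (U(s), V(s))_{L²(Ω)} e^{-s/T} ds`. -/
def innerE {d : ℕ} {Ω : Set (E d)} (T : ℝ) (U V : ℝ → H10 Ω) : ℝ :=
  weighted T fun s => inner ℝ (fn (U s)) (fn (V s))

/-- `(c² ∇U, ∇V)_{L²_e(Q_T)}`; on the diagonal it is `‖c ∇U‖²_{L²_e(Q_T)}`. -/
def energyE {d : ℕ} {Ω : Set (E d)} (T : ℝ) (c : E d → ℝ) (U V : ℝ → H10 Ω) : ℝ :=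
  weighted T fun s => energy c (U s) (V s)

/-- The square of the discrete Newton potential seminorm,
`∫₀ᵀ ‖c ∇ N_h U(s)‖²_{L²(Ω)} e^{-s/T} ds`. -/
def newtonSqE {d : ℕ} {Ω : Set (E d)} (T : ℝ) (c : E d → ℝ) (Sx : Submodule ℝ (H10 Ω))
    (U : ℝ → H10 Ω) : ℝ :=
  weighted T fun s =>
    energy c (discreteNewton c Sx (fn (U s))) (discreteNewton c Sx (fn (U s)))

/-- The bilinear form
`A((U,V),(l,χ)) = ⟨∂_t V, l⟩_e + (c² ∇U, ∇l)_e - (∂_t U, χ)_e + (V, χ)_e`.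
Here `∂_t V` takes its values in `L²(Ω)`, on which the duality pairing of the dual of `H¹₀(Ω)`
with `H¹₀(Ω)` is the scalar product of `L²(Ω)`; `deriv` is the time derivative, which for
elements of a tensor product space exists at almost every time. -/
def formA {d : ℕ} {Ω : Set (E d)} (T : ℝ) (c : E d → ℝ) (U V l χ : ℝ → H10 Ω) : ℝ :=
  innerE T (deriv V) l + energyE T c U l - innerE T (deriv U) χ + innerE T V χ

/-- The trial norm
`(‖∂_t U‖²_e + ‖∂_t V‖²_{N_h,e} + ‖c ∇U‖²_e + ‖V‖²_e)^{1/2}`. -/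
def normV {d : ℕ} {Ω : Set (E d)} (T : ℝ) (c : E d → ℝ) (Sx : Submodule ℝ (H10 Ω))
    (U V : ℝ → H10 Ω) : ℝ :=
  Real.sqrt (innerE T (deriv U) (deriv U) + newtonSqE T c Sx (deriv V) + energyE T c U U
    + innerE T V V)

/-- The test norm `(‖l‖²_e + ‖χ‖²_{N_h,e})^{1/2}`. -/
def normW {d : ℕ} {Ω : Set (E d)} (T : ℝ) (c : E d → ℝ) (Sx : Submodule ℝ (H10 Ω))
    (l χ : ℝ → H10 Ω) : ℝ :=
  Real.sqrt (innerE T l l + newtonSqE T c Sx χ)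

end WaveInfSup

end

/-!
Everything rests on one explicit test pair. With the discrete Newton potential `N = N_h`, take
`l = 2T ∂ₜU + N ∂ₜV` and `χ = 2T ∂ₜV - ∂ₜU`, both in `Sx ⊗ ∂ₜSt`. Split the squared trial norm of
`(U, V)` as `D + P`, where `D = ‖∂ₜU‖²_e + ‖∂ₜV‖²_{N_h,e}` and `P = ‖c ∇U‖²_e + ‖V‖²_e`.

* *Lower bound of the form.* In `A((U,V),(l,χ))` the terms `±2T (∂ₜV, ∂ₜU)_e` cancel. The part
  `N ∂ₜV` of `l` and the part `-∂ₜU` of `χ` produce `D` and two cross terms, which Young's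
  inequality bounds by `(D + P)/2` (`le_form_testPair`). The rest is
  `2T ((c² ∇U, ∇∂ₜU)_e + (V, ∂ₜV)_e)`, which is at least `P`: the weight `e^{-t/T}` makes the time
  derivative coercive on functions vanishing at `0`, and the factor `2T` compensates its constant
  (`integral_le_mul_integral_of_hasDerivAt`, `exists_timeDeriv`). Hence `A ≥ (D + P)/2`.
* *Upper bound of the test norm.* By `(c² ∇N ∂ₜV, ∇N ∂ₜU) = (∂ₜU, N ∂ₜV)` the mixed terms cancel,
  and the Poincaré inequality bounds `N`; so the squared test norm is at most
  `(C²/c₀² + 4T²) D` (`testPair_norm_sq_le`).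

The quotient of the two bounds is the constant claimed. Both test functions are given pointwise
in time, so each estimate is one about vectors of `H¹₀(Ω)`, integrated against the measure
`e^{-t/T} dt`; only the coercivity uses the time dependence. The existence of a Poincaré constant
on a bounded set comes from integrating `φ²` by parts against a coordinate function
(`IsTestFunction.integral_sq_le`).
-/

noncomputable section

namespace WaveInfSup

/-! ### The Poincaré inequality on a bounded open set -/

theorem gradient_add_of_isTestFunction {d : ℕ} {Ω : Set (E d)} {φ ψ : E d → ℝ}
    (hφ : IsTestFunction Ω φ) (hψ : IsTestFunction Ω ψ) (x : E d) :
    gradient (φ + ψ) x = gradient φ x + gradient ψ x := by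
  have h1 := hφ.smooth.differentiable (by simp) x
  have h2 := hψ.smooth.differentiable (by simp) x
  simp only [gradient]
  rw [fderiv_add h1 h2, map_add]

theorem gradient_smul_of_isTestFunction {d : ℕ} {Ω : Set (E d)} {φ : E d → ℝ}
    (hφ : IsTestFunction Ω φ) (a : ℝ) (x : E d) :
    gradient (a • φ) x = a • gradient φ x := by
  have h1 := hφ.smooth.differentiable (by simp) x
  simp only [gradient]
  rw [fderiv_const_smul h1]
  simp

/-- The pairs `(φ, ∇φ)` already form a linear subspace, so taking their span adds nothing. -/
theorem mem_testPairs_of_mem_span {d : ℕ} {Ω : Set (E d)} {p : WithLp 2 (L2 Ω × L2vec Ω)}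
    (hp : p ∈ Submodule.span ℝ (testPairs Ω)) : p ∈ testPairs Ω := by
  induction hp using Submodule.span_induction with
  | mem x hx => exact hx
  | zero =>
    refine ⟨0, ⟨contDiff_const, HasCompactSupport.zero, by simp [tsupport]⟩, ?_, ?_⟩
    · exact Lp.coeFn_zero _ _ _
    · filter_upwards [Lp.coeFn_zero (E d) 2 (volume.restrict Ω)] with x hx
      have : gradient (0 : E d → ℝ) x = 0 := by
        simp [gradient]
      rw [this]
      exact hx
  | add p q _ _ hp hq =>
    obtain ⟨φ, hφ, h1, h2⟩ := hp
    obtain ⟨ψ, hψ, h3, h4⟩ := hq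
    refine ⟨φ + ψ, ⟨hφ.smooth.add hψ.smooth, hφ.compact.add hψ.compact, ?_⟩, ?_, ?_⟩
    · exact (tsupport_add φ ψ).trans (union_subset hφ.support hψ.support)
    · filter_upwards [h1, h3, Lp.coeFn_add p.fst q.fst] with x a b e
      simpa [a, b] using e
    · filter_upwards [h2, h4, Lp.coeFn_add p.snd q.snd] with x a b e
      rw [gradient_add_of_isTestFunction hφ hψ, ← a, ← b]
      exact e
  | smul a p _ hp =>
    obtain ⟨φ, hφ, h1, h2⟩ := hp
    refine ⟨a • φ, ⟨hφ.smooth.const_smul a, hφ.compact.smul_left, ?_⟩, ?_, ?_⟩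
    · exact (tsupport_smul_subset_right (fun _ => a) φ).trans hφ.support
    · filter_upwards [h1, Lp.coeFn_smul a p.fst] with x e f
      simpa [e] using f
    · filter_upwards [h2, Lp.coeFn_smul a p.snd] with x e f
      rw [gradient_smul_of_isTestFunction hφ, ← e]
      exact f

theorem norm_sq_eq_integral_norm_sq {α F : Type*} [MeasurableSpace α] {μ : Measure α}
    [NormedAddCommGroup F] [InnerProductSpace ℝ F] (f : Lp F 2 μ) :
    ‖f‖ ^ 2 = ∫ x, ‖f x‖ ^ 2 ∂μ := by
  rw [← real_inner_self_eq_norm_sq, MeasureTheory.L2.inner_def]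
  simp

theorem coord_sq_le_norm_sq {d : ℕ} (x : E d) (i : Fin d) : x i ^ 2 ≤ ‖x‖ ^ 2 := by
  rw [EuclideanSpace.real_norm_sq_eq]
  exact Finset.single_le_sum (f := fun j => x j ^ 2) (fun _ _ => sq_nonneg _) (Finset.mem_univ i)

/-- The Poincaré inequality for test functions: integrating `φ²` by parts against `x_i`. -/
theorem IsTestFunction.integral_sq_le {d : ℕ} {Ω : Set (E d)} (hΩ : MeasurableSet Ω)
    {φ : E d → ℝ} (hφ : IsTestFunction Ω φ) (i : Fin d) {R : ℝ} (hR : ∀ x ∈ Ω, ‖x‖ ≤ R) :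
    ∫ x in Ω, φ x ^ 2 ≤ (2 * R) ^ 2 * ∫ x in Ω, ‖gradient φ x‖ ^ 2 := by
  have hc : ContDiff ℝ ∞ fun x : E d => x i :=
    (EuclideanSpace.proj i : E d →L[ℝ] ℝ).contDiff
  have hψ : IsTestFunction Ω fun x => x i * φ x :=
    ⟨hc.mul hφ.smooth, hφ.compact.mul_left, (tsupport_mul_subset_right).trans hφ.support⟩
  have hcg : Continuous fun x => gradient φ x := by
    simp only [gradient]
    exact (InnerProductSpace.toDual ℝ (E d)).symm.continuous.comp
      (hφ.smooth.continuous_fderiv (by simp))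
  have hgc : HasCompactSupport fun x => gradient φ x := by
    refine (hφ.compact.fderiv (𝕜 := ℝ)).comp_left (g := (InnerProductSpace.toDual ℝ (E d)).symm) ?_
    simp
  have hgi : Continuous fun x => (gradient φ x) i :=
    (EuclideanSpace.proj i : E d →L[ℝ] ℝ).continuous.comp hcg
  have hderiv : ∀ x, (gradient (fun x : E d => x i * φ x) x) i
      = φ x + x i * (gradient φ x) i := by
    intro x
    have h1 : HasFDerivAt (fun x : E d => x i) (EuclideanSpace.proj i : E d →L[ℝ] ℝ) x :=
      (EuclideanSpace.proj i : E d →L[ℝ] ℝ).hasFDerivAt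
    have h2 := (hφ.smooth.differentiable (by simp) x).hasFDerivAt
    rw [gradient_coord, gradient_coord, (h1.fun_mul h2).fderiv]
    simp
    ring
  have key := hφ.integral_by_parts hψ i
  simp only [hderiv] at key
  have I1 : Integrable (fun x => φ x ^ 2) (volume.restrict Ω) :=
    ((hφ.smooth.continuous.pow 2).integrable_of_hasCompactSupport
      (by simpa only [pow_two] using hφ.compact.mul_left)).restrict
  have I2 : Integrable (fun x => x i * φ x * (gradient φ x) i) (volume.restrict Ω) :=
    (((hc.continuous.mul hφ.smooth.continuous).mul hgi).integrable_of_hasCompactSupport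
      hψ.compact.mul_right).restrict
  have I3 : Integrable (fun x => ‖gradient φ x‖ ^ 2) (volume.restrict Ω) :=
    ((hcg.norm.pow 2).integrable_of_hasCompactSupport
      (by simpa only [pow_two] using hgc.norm.mul_left)).restrict
  have e : ∫ x in Ω, (φ x + x i * (gradient φ x) i) * φ x
      = (∫ x in Ω, φ x ^ 2) + ∫ x in Ω, x i * φ x * (gradient φ x) i := by
    rw [← integral_add I1 I2]
    exact integral_congr_ae (.of_forall fun x => by ring)
  rw [e] at key
  have hle : ∫ x in Ω, -2 * (x i * φ x * (gradient φ x) i)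
      ≤ ∫ x in Ω, (1 / 2 * φ x ^ 2 + 2 * R ^ 2 * ‖gradient φ x‖ ^ 2) := by
    refine integral_mono_ae (I2.const_mul _) ((I1.const_mul _).add (I3.const_mul _)) ?_
    filter_upwards [ae_restrict_mem hΩ] with x hx
    have h1 : x i ^ 2 ≤ R ^ 2 :=
      (coord_sq_le_norm_sq x i).trans (pow_le_pow_left₀ (norm_nonneg _) (hR x hx) 2)
    have h2 := mul_le_mul h1 (coord_sq_le_norm_sq (gradient φ x) i) (sq_nonneg _) (sq_nonneg R)
    change -2 * (x i * φ x * (gradient φ x) i) ≤ 1 / 2 * φ x ^ 2 + 2 * R ^ 2 * ‖gradient φ x‖ ^ 2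
    -- Young's inequality with weights chosen so that half of `∫ φ²` can be absorbed.
    nlinarith [sq_nonneg (φ x + 2 * (x i * (gradient φ x) i))]
  rw [integral_const_mul, integral_add (I1.const_mul _) (I3.const_mul _), integral_const_mul,
    integral_const_mul] at hle
  nlinarith

theorem exists_isPoincareConstant {d : ℕ} (hd : 1 ≤ d) {Ω : Set (E d)} (hΩ : IsOpen Ω)
    (hΩb : Bornology.IsBounded Ω) : ∃ C : ℝ, IsPoincareConstant Ω C := by
  obtain ⟨R, hR0, hR⟩ := hΩb.exists_pos_norm_le
  refine ⟨2 * R, by positivity, fun v => ?_⟩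
  have hcl : IsClosed {p : WithLp 2 (L2 Ω × L2vec Ω) | ‖p.fst‖ ≤ 2 * R * ‖p.snd‖} :=
    isClosed_le (WithLp.fstL 2 ℝ (L2 Ω) (L2vec Ω)).continuous.norm
      (continuous_const.mul (WithLp.sndL 2 ℝ (L2 Ω) (L2vec Ω)).continuous.norm)
  refine closure_minimal (fun p hp => ?_) hcl v.2
  obtain ⟨φ, hφ, h1, h2⟩ := mem_testPairs_of_mem_span hp
  have hmain := hφ.integral_sq_le hΩ.measurableSet ⟨0, hd⟩ hR
  have e1 : ‖p.fst‖ ^ 2 = ∫ x in Ω, φ x ^ 2 := by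
    rw [norm_sq_eq_integral_norm_sq]
    refine integral_congr_ae ?_
    filter_upwards [h1] with x hx
    rw [hx, Real.norm_eq_abs, sq_abs]
  have e2 : ‖p.snd‖ ^ 2 = ∫ x in Ω, ‖gradient φ x‖ ^ 2 := by
    rw [norm_sq_eq_integral_norm_sq]
    refine integral_congr_ae ?_
    filter_upwards [h2] with x hx
    rw [hx]
  rw [← e1, ← e2, ← mul_pow] at hmain
  exact le_of_sq_le_sq hmain (by positivity)

/-! ### The bilinear forms in space and the discrete Newton potential -/

theorem integrable_energy {d : ℕ} {Ω : Set (E d)} {c : E d → ℝ}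
    (hc : MemLp c ⊤ (volume.restrict Ω)) (u v : H10 Ω) :
    Integrable (fun x => c x ^ 2 * inner ℝ (grad u x) (grad v x)) (volume.restrict Ω) := by
  have h1 : MemLp (fun x => c x • grad u x) 2 (volume.restrict Ω) := (Lp.memLp _).smul hc
  have h2 : MemLp (fun x => c x • grad v x) 2 (volume.restrict Ω) := (Lp.memLp _).smul hc
  refine (L2.integrable_inner (𝕜 := ℝ) h1.toLp h2.toLp).congr ?_
  filter_upwards [h1.coeFn_toLp, h2.coeFn_toLp] with x e1 e2
  rw [e1, e2, real_inner_smul_left, real_inner_smul_right]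
  ring

/-- The weak gradient as a linear map on `H¹₀(Ω)`. -/
def gradₗ {d : ℕ} (Ω : Set (E d)) : H10 Ω →ₗ[ℝ] L2vec Ω :=
  (WithLp.sndL 2 ℝ (L2 Ω) (L2vec Ω)).toLinearMap ∘ₗ (H10 Ω).subtype

/-- The embedding of `H¹₀(Ω)` into `L²(Ω)` as a linear map. -/
def fnₗ {d : ℕ} (Ω : Set (E d)) : H10 Ω →ₗ[ℝ] L2 Ω :=
  (WithLp.fstL 2 ℝ (L2 Ω) (L2vec Ω)).toLinearMap ∘ₗ (H10 Ω).subtype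

theorem grad_add {d : ℕ} {Ω : Set (E d)} (u v : H10 Ω) : grad (u + v) = grad u + grad v :=
  (gradₗ Ω).map_add u v

theorem grad_smul {d : ℕ} {Ω : Set (E d)} (a : ℝ) (u : H10 Ω) : grad (a • u) = a • grad u :=
  (gradₗ Ω).map_smul a u

theorem energy_comm {d : ℕ} {Ω : Set (E d)} (c : E d → ℝ) (u v : H10 Ω) :
    energy c u v = energy c v u := by
  simp only [energy, real_inner_comm]

theorem energy_add_left {d : ℕ} {Ω : Set (E d)} {c : E d → ℝ}
    (hc : MemLp c ⊤ (volume.restrict Ω)) (u v w : H10 Ω) :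
    energy c (u + v) w = energy c u w + energy c v w := by
  rw [energy, energy, energy, ← integral_add (integrable_energy hc u w) (integrable_energy hc v w)]
  refine integral_congr_ae ?_
  filter_upwards [Lp.coeFn_add (grad u) (grad v)] with x hx
  rw [grad_add, hx, Pi.add_apply, inner_add_left]
  ring

theorem energy_smul_left {d : ℕ} {Ω : Set (E d)} (c : E d → ℝ) (a : ℝ) (u w : H10 Ω) :
    energy c (a • u) w = a * energy c u w := by
  rw [energy, energy, ← integral_const_mul]
  refine integral_congr_ae ?_
  filter_upwards [Lp.coeFn_smul a (grad u)] with x hx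
  rw [grad_smul, hx, Pi.smul_apply, real_inner_smul_left]
  ring

/-- The form `(c² ∇u, ∇v)_{L²(Ω)}` as a bilinear map; boundedness of `c` makes it additive. -/
def energyₗ {d : ℕ} {Ω : Set (E d)} {c : E d → ℝ} (hc : MemLp c ⊤ (volume.restrict Ω)) :
    H10 Ω →ₗ[ℝ] H10 Ω →ₗ[ℝ] ℝ :=
  LinearMap.mk₂ ℝ (energy c) (energy_add_left hc) (energy_smul_left c)
    (fun u v w => by
      rw [energy_comm, energy_add_left hc, energy_comm c v u, energy_comm c w u])
    (fun a u v => by rw [energy_comm, energy_smul_left, energy_comm c v u, smul_eq_mul])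

/-- The scalar product of `L²(Ω)`, restricted to `H¹₀(Ω)`, as a bilinear map. -/
def massₗ {d : ℕ} (Ω : Set (E d)) : H10 Ω →ₗ[ℝ] H10 Ω →ₗ[ℝ] ℝ :=
  (innerₗ (L2 Ω)).compl₁₂ (fnₗ Ω) (fnₗ Ω)

theorem energyₗ_apply {d : ℕ} {Ω : Set (E d)} {c : E d → ℝ}
    (hc : MemLp c ⊤ (volume.restrict Ω)) (u v : H10 Ω) : energyₗ hc u v = energy c u v := rfl

theorem massₗ_apply {d : ℕ} {Ω : Set (E d)} (u v : H10 Ω) :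
    massₗ Ω u v = inner ℝ (fn u) (fn v) := rfl

theorem energy_self_nonneg {d : ℕ} {Ω : Set (E d)} (c : E d → ℝ) (u : H10 Ω) :
    0 ≤ energy c u u :=
  integral_nonneg fun _ => mul_nonneg (sq_nonneg _) real_inner_self_nonneg

theorem sq_mul_norm_grad_sq_le_energy {d : ℕ} {Ω : Set (E d)} {c : E d → ℝ} {c₀ : ℝ}
    (hc₀ : 0 < c₀) (hc : MemLp c ⊤ (volume.restrict Ω))
    (hcc₀ : ∀ᵐ x ∂(volume.restrict Ω), c₀ ≤ c x) (u : H10 Ω) :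
    c₀ ^ 2 * ‖grad u‖ ^ 2 ≤ energy c u u := by
  rw [← real_inner_self_eq_norm_sq, MeasureTheory.L2.inner_def, ← integral_const_mul]
  refine integral_mono_ae ((L2.integrable_inner (𝕜 := ℝ) (grad u) (grad u)).const_mul _)
    (integrable_energy hc u u) ?_
  filter_upwards [hcc₀] with x hx
  exact mul_le_mul_of_nonneg_right (pow_le_pow_left₀ hc₀.le hx 2) real_inner_self_nonneg

theorem norm_fn_sq_le_energy {d : ℕ} {Ω : Set (E d)} {c : E d → ℝ} {c₀ C : ℝ}
    (hc₀ : 0 < c₀) (hc : MemLp c ⊤ (volume.restrict Ω))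
    (hcc₀ : ∀ᵐ x ∂(volume.restrict Ω), c₀ ≤ c x) (hC : IsPoincareConstant Ω C) (u : H10 Ω) :
    ‖fn u‖ ^ 2 ≤ C ^ 2 / c₀ ^ 2 * energy c u u := by
  have h1 := pow_le_pow_left₀ (norm_nonneg _) (hC.2 u) 2
  have h2 := mul_le_mul_of_nonneg_left (sq_mul_norm_grad_sq_le_energy hc₀ hc hcc₀ u)
    (show 0 ≤ C ^ 2 / c₀ ^ 2 by positivity)
  have h3 : C ^ 2 / c₀ ^ 2 * (c₀ ^ 2 * ‖grad u‖ ^ 2) = (C * ‖grad u‖) ^ 2 := by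
    field_simp
  linarith

theorem eq_zero_of_fn_eq_zero {d : ℕ} {Ω : Set (E d)} (hΩ : IsOpen Ω) {u : H10 Ω}
    (h : fn u = 0) : u = 0 :=
  H10_ext hΩ u 0 (h.trans (fnₗ Ω).map_zero.symm)

theorem eq_zero_of_energy_eq_zero {d : ℕ} {Ω : Set (E d)} (hΩ : IsOpen Ω) {c : E d → ℝ}
    {c₀ C : ℝ} (hc₀ : 0 < c₀) (hc : MemLp c ⊤ (volume.restrict Ω))
    (hcc₀ : ∀ᵐ x ∂(volume.restrict Ω), c₀ ≤ c x) (hC : IsPoincareConstant Ω C) {u : H10 Ω}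
    (h : energy c u u = 0) : u = 0 := by
  have h1 := norm_fn_sq_le_energy hc₀ hc hcc₀ hC u
  rw [h, mul_zero] at h1
  exact eq_zero_of_fn_eq_zero hΩ (norm_eq_zero.1 (pow_eq_zero_iff two_ne_zero |>.1
    (le_antisymm h1 (sq_nonneg _))))

/-- A positive definite bilinear form on a finite-dimensional subspace represents every linear
family of functionals by a linear map into the subspace. -/
theorem exists_linearMap_representing {X Y : Type*} [AddCommGroup X] [Module ℝ X]
    [AddCommGroup Y] [Module ℝ Y] (b : X →ₗ[ℝ] X →ₗ[ℝ] ℝ) (S : Submodule ℝ X)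
    [FiniteDimensional ℝ S] (hb : ∀ x ∈ S, b x x = 0 → x = 0) (f : Y →ₗ[ℝ] X →ₗ[ℝ] ℝ) :
    ∃ N : Y →ₗ[ℝ] X, ∀ y, N y ∈ S ∧ ∀ v ∈ S, b (N y) v = f y v := by
  let B : S →ₗ[ℝ] Module.Dual ℝ S := b.compl₁₂ S.subtype S.subtype
  have hinj : Function.Injective B := by
    refine (injective_iff_map_eq_zero B).2 fun x hx => Subtype.ext (hb x x.2 ?_)
    exact LinearMap.congr_fun hx x
  let e : S ≃ₗ[ℝ] Module.Dual ℝ S :=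
    LinearEquiv.ofInjectiveOfFinrankEq B hinj Subspace.dual_finrank_eq.symm
  refine ⟨S.subtype ∘ₗ e.symm.toLinearMap ∘ₗ f.compl₂ S.subtype, fun y => ⟨?_, fun v hv => ?_⟩⟩
  · exact (e.symm (f.compl₂ S.subtype y)).2
  · have h : B (e.symm (f.compl₂ S.subtype y)) = f.compl₂ S.subtype y :=
      e.apply_symm_apply _
    exact LinearMap.congr_fun h ⟨v, hv⟩

/-- The discrete Newton potential, precomposed with the embedding of `H¹₀(Ω)` into `L²(Ω)`, is
a linear map into `S` and has the defining property. -/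
theorem exists_discreteNewton_linearMap {d : ℕ} {Ω : Set (E d)} (hΩ : IsOpen Ω) {c : E d → ℝ}
    {c₀ C : ℝ} (hc₀ : 0 < c₀) (hc : MemLp c ⊤ (volume.restrict Ω))
    (hcc₀ : ∀ᵐ x ∂(volume.restrict Ω), c₀ ≤ c x) (hC : IsPoincareConstant Ω C)
    (S : Submodule ℝ (H10 Ω)) [FiniteDimensional ℝ S] :
    ∃ N : H10 Ω →ₗ[ℝ] H10 Ω, (∀ u, N u = discreteNewton c S (fn u)) ∧ (∀ u, N u ∈ S) ∧
      ∀ u, ∀ v ∈ S, energy c (N u) v = inner ℝ (fn u) (fn v) := by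
  have hpd : ∀ u : H10 Ω, energyₗ hc u u = 0 → u = 0 := fun u h =>
    eq_zero_of_energy_eq_zero hΩ hc₀ hc hcc₀ hC h
  obtain ⟨N, hN⟩ := exists_linearMap_representing (energyₗ hc) S (fun u _ => hpd u) (massₗ Ω)
  refine ⟨N, fun u => ?_, fun u => (hN u).1, fun u => (hN u).2⟩
  have hex : ∃ z ∈ S, ∀ v ∈ S, energy c z v = inner ℝ (fn u) (fn v) :=
    ⟨N u, (hN u).1, (hN u).2⟩
  rw [discreteNewton, dif_pos hex]
  obtain ⟨hz, hzv⟩ := hex.choose_spec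
  have hmem := S.sub_mem (hN u).1 hz
  refine sub_eq_zero.1 (hpd _ ?_)
  rw [LinearMap.map_sub₂, (hN u).2 _ hmem, energyₗ_apply, hzv _ hmem, massₗ_apply,
    sub_self]

/-! ### Weighted integration in time -/

/-- The measure `e^{-s/T} ds` on `(0,T)`, so that `weighted T` is integration against it. -/
def expMeasure (T : ℝ) : Measure ℝ :=
  (volume.restrict (Ioo 0 T)).withDensity fun s => ENNReal.ofReal (Real.exp (-s / T))

theorem measurable_expDensity (T : ℝ) :
    Measurable fun s : ℝ => ENNReal.ofReal (Real.exp (-s / T)) := by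
  fun_prop

theorem expMeasure_le {T : ℝ} (hT : 0 < T) : expMeasure T ≤ volume.restrict (Ioo 0 T) := by
  refine (withDensity_mono ?_).trans withDensity_one.le
  filter_upwards [ae_restrict_mem measurableSet_Ioo] with s hs
  rw [Pi.one_apply, ENNReal.ofReal_le_one, Real.exp_le_one_iff]
  exact div_nonpos_of_nonpos_of_nonneg (by linarith [hs.1]) hT.le

theorem ae_expMeasure_iff {T : ℝ} {p : ℝ → Prop} :
    (∀ᵐ t ∂expMeasure T, p t) ↔ ∀ᵐ t ∂volume.restrict (Ioo 0 T), p t := by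
  refine ⟨fun h => ?_, fun h => (withDensity_absolutelyContinuous _ _).ae_le h⟩
  refine (withDensity_absolutelyContinuous' (measurable_expDensity T).aemeasurable ?_).ae_le h
  exact .of_forall fun s => (ENNReal.ofReal_pos.2 (Real.exp_pos _)).ne'

theorem weighted_eq_integral {T : ℝ} (hT : 0 < T) (f : ℝ → ℝ) :
    weighted T f = ∫ t, f t ∂expMeasure T := by
  rw [weighted, intervalIntegral.integral_of_le hT.le, integral_Ioc_eq_integral_Ioo, expMeasure,
    integral_withDensity_eq_integral_toReal_smul (measurable_expDensity T)
      (.of_forall fun _ => ENNReal.ofReal_lt_top)]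
  refine integral_congr_ae (.of_forall fun s => ?_)
  simp only [smul_eq_mul]
  rw [ENNReal.toReal_ofReal (Real.exp_pos _).le, mul_comm]

/-! ### Tensor product functions and their time derivatives -/

theorem MemH1zero.memLp {T : ℝ} (hT : 0 < T) {w : ℝ → ℝ} (hw : MemH1zero T w) :
    MemLp w 2 (volume.restrict (Ioo 0 T)) := by
  have hcont : ContinuousOn w (Icc 0 T) := by
    simpa [uIcc_of_le hT.le] using hw.absolutelyContinuous.continuousOn
  obtain ⟨M, hM⟩ := isCompact_Icc.exists_bound_of_continuousOn hcont
  refine MemLp.of_bound ((hcont.mono Ioo_subset_Icc_self).aestronglyMeasurable measurableSet_Ioo)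
    M ?_
  filter_upwards [ae_restrict_mem measurableSet_Ioo] with s hs
  exact hM s (Ioo_subset_Icc_self hs)

theorem memLp_of_mem_timeDeriv {T : ℝ} {St : Submodule ℝ (ℝ → ℝ)}
    (hSt : ∀ w ∈ St, MemH1zero T w) {w : ℝ → ℝ} (hw : w ∈ timeDeriv St) :
    MemLp w 2 (volume.restrict (Ioo 0 T)) := by
  induction hw using Submodule.span_induction with
  | mem x hx =>
    obtain ⟨v, hv, rfl⟩ := hx
    exact (hSt v hv).deriv_memLp
  | zero => exact MemLp.zero
  | add x y _ _ hx hy => exact hx.add hy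
  | smul a x _ hx => exact hx.const_smul a

theorem mem_of_mem_tensor {d : ℕ} {Ω : Set (E d)} {Sx : Submodule ℝ (H10 Ω)}
    {St : Submodule ℝ (ℝ → ℝ)} {F : ℝ → H10 Ω} (hF : F ∈ tensor Sx St) (t : ℝ) : F t ∈ Sx := by
  induction hF using Submodule.span_induction with
  | mem x hx =>
    obtain ⟨φ, hφ, w, _, rfl⟩ := hx
    exact Sx.smul_mem _ hφ
  | zero => exact Sx.zero_mem
  | add x y _ _ hx hy => exact Sx.add_mem hx hy
  | smul a x _ hx => exact Sx.smul_mem a hx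

theorem map_mem_tensor {d : ℕ} {Ω : Set (E d)} {Sx : Submodule ℝ (H10 Ω)}
    {St : Submodule ℝ (ℝ → ℝ)} (N : H10 Ω →ₗ[ℝ] H10 Ω) (hN : ∀ u, N u ∈ Sx) {F : ℝ → H10 Ω}
    (hF : F ∈ tensor Sx St) : (fun t => N (F t)) ∈ tensor Sx St := by
  induction hF using Submodule.span_induction with
  | mem x hx =>
    obtain ⟨φ, _, w, hw, rfl⟩ := hx
    exact Submodule.subset_span ⟨N φ, hN φ, w, hw, funext fun t => N.map_smul _ _⟩
  | zero =>
    simp only [Pi.zero_apply, map_zero]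
    exact (tensor Sx St).zero_mem
  | add x y _ _ hx hy =>
    simp only [Pi.add_apply, map_add]
    exact (tensor Sx St).add_mem hx hy
  | smul a x _ hx =>
    simp only [Pi.smul_apply, map_smul]
    exact (tensor Sx St).smul_mem a hx

/-- A bilinear form evaluated on two tensor product functions with square integrable time
factors is integrable in time. No continuity of the form is needed. -/
theorem integrable_bilin_of_mem_tensor {d : ℕ} {Ω : Set (E d)} {T : ℝ} (hT : 0 < T)
    (b : H10 Ω →ₗ[ℝ] H10 Ω →ₗ[ℝ] ℝ) {Sx : Submodule ℝ (H10 Ω)} {St St' : Submodule ℝ (ℝ → ℝ)}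
    (hSt : ∀ w ∈ St, MemLp w 2 (volume.restrict (Ioo 0 T)))
    (hSt' : ∀ w ∈ St', MemLp w 2 (volume.restrict (Ioo 0 T))) {F G : ℝ → H10 Ω}
    (hF : F ∈ tensor Sx St) (hG : G ∈ tensor Sx St') :
    Integrable (fun t => b (F t) (G t)) (expMeasure T) := by
  induction hF using Submodule.span_induction with
  | mem x hx =>
    obtain ⟨φ, _, w, hw, rfl⟩ := hx
    induction hG using Submodule.span_induction with
    | mem x hx =>
      obtain ⟨ψ, _, v, hv, rfl⟩ := hx
      refine (((hSt w hw).mono_measure (expMeasure_le hT)).integrable_mul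
        ((hSt' v hv).mono_measure (expMeasure_le hT)) |>.mul_const (b φ ψ)).congr
          (.of_forall fun t => ?_)
      simp
      ring
    | zero => simp
    | add x y _ _ hx hy => exact (hx.add hy).congr (.of_forall fun t => by simp [mul_add])
    | smul a x _ hx => simpa using hx.const_mul a
  | zero => simp
  | add x y _ _ hx hy => exact (hx.add hy).congr (.of_forall fun t => by simp)
  | smul a x _ hx => simpa using hx.const_mul a

theorem exists_sum_of_mem_tensor {d : ℕ} {Ω : Set (E d)} {Sx : Submodule ℝ (H10 Ω)}
    {St : Submodule ℝ (ℝ → ℝ)} {F : ℝ → H10 Ω} (hF : F ∈ tensor Sx St) :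
    ∃ (n : ℕ) (φ : Fin n → H10 Ω) (w : Fin n → ℝ → ℝ), (∀ i, φ i ∈ Sx) ∧ (∀ i, w i ∈ St) ∧
      F = fun t => ∑ i, w i t • φ i := by
  obtain ⟨n, a, g, rfl⟩ := Submodule.mem_span_set'.1 hF
  choose φ hφ w hw h using fun i => (g i).2
  refine ⟨n, fun i => a i • φ i, w, fun i => Sx.smul_mem _ (hφ i), hw, funext fun t => ?_⟩
  simp only [Finset.sum_apply, Pi.smul_apply]
  refine Finset.sum_congr rfl fun i _ => ?_
  rw [h i, smul_comm]

theorem absolutelyContinuousOnInterval_sum {ι : Type*} {a b : ℝ} (s : Finset ι)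
    {f : ι → ℝ → ℝ} (hf : ∀ i, AbsolutelyContinuousOnInterval (f i) a b) :
    AbsolutelyContinuousOnInterval (fun t => ∑ i ∈ s, f i t) a b := by
  classical
  induction s using Finset.induction_on with
  | empty =>
    simp only [Finset.sum_empty]
    exact (contDiff_const.contDiffOn).absolutelyContinuousOnInterval
  | insert i s hi ih =>
    simp only [Finset.sum_insert hi]
    exact (hf i).fun_add ih

/-- The exponential weight makes the time derivative coercive: for an absolutely continuous
`q ≥ 0` with `q(0) = 0`, integrating `(q e^{-t/T})'` gives
`∫ q e^{-t/T} ≤ T ∫ q' e^{-t/T}`. -/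
theorem integral_le_mul_integral_of_hasDerivAt {T : ℝ} (hT : 0 < T) {q q' : ℝ → ℝ}
    (hq : AbsolutelyContinuousOnInterval q 0 T) (hq0 : q 0 = 0) (hqT : 0 ≤ q T)
    (hq' : ∀ᵐ t ∂volume.restrict (Ioo 0 T), HasDerivAt q (q' t) t)
    (hi : Integrable q (expMeasure T)) (hi' : Integrable q' (expMeasure T)) :
    ∫ t, q t ∂expMeasure T ≤ T * ∫ t, q' t ∂expMeasure T := by
  have hg : ∀ t : ℝ, HasDerivAt (fun t => Real.exp (-t / T))
      (Real.exp (-t / T) * (-1 / T)) t := fun t => ((hasDerivAt_neg' t).div_const T).exp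
  have hgac : AbsolutelyContinuousOnInterval (fun t => Real.exp (-t / T)) 0 T := by
    have : ContDiff ℝ 1 fun t : ℝ => Real.exp (-t / T) := by fun_prop
    exact this.contDiffOn.absolutelyContinuousOnInterval
  have key := hq.integral_deriv_mul_eq_sub hgac
  have e : ∫ t in (0 : ℝ)..T, (deriv q t * Real.exp (-t / T)
      + q t * deriv (fun t => Real.exp (-t / T)) t)
      = weighted T fun t => q' t - T⁻¹ * q t := by
    rw [weighted, intervalIntegral.integral_of_le hT.le, intervalIntegral.integral_of_le hT.le,
      integral_Ioc_eq_integral_Ioo, integral_Ioc_eq_integral_Ioo]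
    refine integral_congr_ae ?_
    filter_upwards [hq'] with t ht
    rw [ht.deriv, (hg t).deriv]
    ring
  rw [e, weighted_eq_integral hT, integral_sub hi' (hi.const_mul _), integral_const_mul, hq0,
    zero_mul, sub_zero] at key
  have hpos : 0 ≤ q T * Real.exp (-T / T) := mul_nonneg hqT (Real.exp_pos _).le
  have h : T⁻¹ * ∫ t, q t ∂expMeasure T ≤ ∫ t, q' t ∂expMeasure T := by linarith
  rwa [inv_mul_le_iff₀ hT] at h

/-- The time derivative of `U ∈ Sx ⊗ St` agrees almost everywhere with some `U' ∈ Sx ⊗ ∂ₜSt`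
(`deriv U` itself need not lie there, as it may vanish where the time factors are not
differentiable), and `‖U‖² ≤ 2T (U, U')` in every weighted seminorm given by a symmetric positive
semidefinite form in space. -/
theorem exists_timeDeriv {d : ℕ} {Ω : Set (E d)} {T : ℝ} (hT : 0 < T)
    {Sx : Submodule ℝ (H10 Ω)} {St : Submodule ℝ (ℝ → ℝ)} (hSt : ∀ w ∈ St, MemH1zero T w)
    {U : ℝ → H10 Ω} (hU : U ∈ tensor Sx St) :
    ∃ U' ∈ tensor Sx (timeDeriv St), (∀ᵐ t ∂expMeasure T, deriv U t = U' t) ∧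
      ∀ b : H10 Ω →ₗ[ℝ] H10 Ω →ₗ[ℝ] ℝ, (∀ u v, b u v = b v u) → (∀ u, 0 ≤ b u u) →
        ∫ t, b (U t) (U t) ∂expMeasure T ≤ 2 * T * ∫ t, b (U t) (U' t) ∂expMeasure T := by
  obtain ⟨n, φ, w, hφ, hw, rfl⟩ := exists_sum_of_mem_tensor hU
  have hU' : (fun t => ∑ i, deriv (w i) t • φ i) ∈ tensor Sx (timeDeriv St) := by
    have : (fun t => ∑ i, deriv (w i) t • φ i) = ∑ i, fun t => deriv (w i) t • φ i := by
      ext1 t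
      rw [Finset.sum_apply]
    rw [this]
    exact Submodule.sum_mem _ fun i _ => Submodule.subset_span
      ⟨φ i, hφ i, deriv (w i), Submodule.subset_span ⟨w i, hw i, rfl⟩, rfl⟩
  have hd : ∀ᵐ t ∂volume.restrict (Ioo 0 T), ∀ i, HasDerivAt (w i) (deriv (w i) t) t := by
    refine ae_all_iff.2 fun i => ?_
    rw [ae_restrict_iff' measurableSet_Ioo]
    filter_upwards [(hSt _ (hw i)).absolutelyContinuous.ae_differentiableAt] with t ht hmem
    refine (ht ?_).hasDerivAt
    rw [uIcc_of_le hT.le]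
    exact Ioo_subset_Icc_self hmem
  refine ⟨_, hU', ae_expMeasure_iff.2 ?_, fun b hsymm hpos => ?_⟩
  · filter_upwards [hd] with t ht
    exact (HasDerivAt.fun_sum fun i _ => (ht i).smul_const (φ i)).deriv
  · have hL : ∀ w ∈ St, MemLp w 2 (volume.restrict (Ioo 0 T)) := fun w hw => (hSt w hw).memLp hT
    have hL' : ∀ w ∈ timeDeriv St, MemLp w 2 (volume.restrict (Ioo 0 T)) := fun w hw =>
      memLp_of_mem_timeDeriv hSt hw
    have expand : ∀ x y : Fin n → ℝ, b (∑ i, x i • φ i) (∑ j, y j • φ j)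
        = ∑ i, ∑ j, x i * y j * b (φ i) (φ j) := by
      intro x y
      simp only [map_sum, LinearMap.sum_apply, map_smul, LinearMap.smul_apply, smul_eq_mul,
        Finset.mul_sum]
      rw [Finset.sum_comm]
      exact Finset.sum_congr rfl fun i _ => Finset.sum_congr rfl fun j _ => by ring
    have h := integral_le_mul_integral_of_hasDerivAt hT
      (q := fun t => b (∑ i, w i t • φ i) (∑ i, w i t • φ i))
      (q' := fun t => 2 * b (∑ i, w i t • φ i) (∑ i, deriv (w i) t • φ i)) ?_ ?_ (hpos _) ?_
      (integrable_bilin_of_mem_tensor hT b hL hL hU hU)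
      ((integrable_bilin_of_mem_tensor hT b hL hL' hU hU').const_mul 2)
    · rw [integral_const_mul] at h
      linarith
    · simp only [expand]
      refine absolutelyContinuousOnInterval_sum _ fun i =>
        absolutelyContinuousOnInterval_sum _ fun j => ?_
      have := ((hSt _ (hw i)).absolutelyContinuous.fun_mul
        (hSt _ (hw j)).absolutelyContinuous).const_mul (b (φ i) (φ j))
      simpa only [mul_comm] using this
    · simp [(hSt _ (hw _)).zero]
    · filter_upwards [hd] with t ht
      have e : 2 * b (∑ i, w i t • φ i) (∑ i, deriv (w i) t • φ i)
          = ∑ i, ∑ j, (deriv (w i) t * w j t + w i t * deriv (w j) t) * b (φ i) (φ j) := by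
        rw [two_mul]
        nth_rewrite 1 [hsymm]
        rw [expand, expand, ← Finset.sum_add_distrib]
        simp only [← Finset.sum_add_distrib, add_mul]
      rw [e]
      simp only [expand]
      exact HasDerivAt.fun_sum fun i _ => HasDerivAt.fun_sum fun j _ =>
        ((ht i).fun_mul (ht j)).mul_const _

/-! ### Estimates for the test pair -/

/-- Lower bound for the integrand of the form at the test pair `(a u' + N v', a v' - u')`. The
terms `a (v', u')` cancel, and the two cross terms `K(u, N v')` and `M(v, u')` are absorbed by
Young's inequality. -/
theorem le_form_testPair {X : Type*} [AddCommGroup X] [Module ℝ X]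
    {M K : X →ₗ[ℝ] X →ₗ[ℝ] ℝ} (hM : ∀ u v, M u v = M v u) (hM0 : ∀ u, 0 ≤ M u u)
    (hK : ∀ u v, K u v = K v u) (hK0 : ∀ u, 0 ≤ K u u) {S : Submodule ℝ X} {N : X →ₗ[ℝ] X}
    (hNS : ∀ u, N u ∈ S) (hN : ∀ u, ∀ v ∈ S, K (N u) v = M u v) (a : ℝ) (u u' v v' : X) :
    a * K u u' + a * M v v' + (M u' u' + K (N v') (N v')) / 2 - (K u u + M v v) / 2
      ≤ M v' (a • u' + N v') + K u (a • u' + N v') - M u' (a • v' - u')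
        + M v (a • v' - u') := by
  have h1 := hK0 (u + N v')
  have h2 := hM0 (v - u')
  simp only [map_add, map_sub, LinearMap.add_apply, LinearMap.sub_apply, map_smul,
    smul_eq_mul] at h1 h2 ⊢
  rw [hK (N v') u] at h1
  rw [hM u' v] at h2
  rw [← hN v' _ (hNS v'), hM v' u']
  linarith

/-- Upper bound for the integrand of the squared test norm of the pair
`(a u' + N v', a v' - u')`. The cross terms cancel since `K(N v', N u') = M(u', N v')`, and `N`
is bounded by the constant `k` of the Poincaré inequality `M ≤ k K`. -/
theorem testPair_norm_sq_le {X : Type*} [AddCommGroup X] [Module ℝ X]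
    {M K : X →ₗ[ℝ] X →ₗ[ℝ] ℝ} (hM : ∀ u v, M u v = M v u) (hM0 : ∀ u, 0 ≤ M u u)
    (hK : ∀ u v, K u v = K v u) {k : ℝ} (hk : 0 < k) (hMK : ∀ u, M u u ≤ k * K u u)
    {S : Submodule ℝ X} {N : X →ₗ[ℝ] X} (hNS : ∀ u, N u ∈ S)
    (hN : ∀ u, ∀ v ∈ S, K (N u) v = M u v) (a : ℝ) (u' v' : X) :
    M (a • u' + N v') (a • u' + N v') + K (N (a • v' - u')) (N (a • v' - u'))
      ≤ (k + a ^ 2) * (M u' u' + K (N v') (N v')) := by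
  have h1 := hMK (N v')
  have h2 := hMK (N u')
  -- `K(N u', N u') = M(u', N u') ≤ k M(u', u')` by Young's inequality.
  have h3 := hM0 (k • u' - N u')
  have h4 : K (N u') (N u') ≤ k * M u' u' := by
    simp only [map_sub, LinearMap.sub_apply, map_smul, LinearMap.smul_apply, smul_eq_mul] at h3
    rw [hM (N u') u', ← hN u' _ (hNS u')] at h3
    refine le_of_mul_le_mul_left ?_ hk
    nlinarith
  simp only [map_add, map_sub, LinearMap.add_apply, LinearMap.sub_apply, map_smul,
    LinearMap.smul_apply, smul_eq_mul]
  rw [hM (N v') u', hK (N v') (N u'), hN u' _ (hNS v')]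
  linarith

set_option maxHeartbeats 1000000 in
/-- The estimates for the test pair `l = 2T U' + N V'`, `χ = 2T V' - U'`, integrated in time, for
abstract forms `M`, `K` in space that satisfy the Poincaré inequality `M ≤ k K`. The functions
`U'`, `V'` play the part of `∂ₜU`, `∂ₜV`, of which only coercivity is used. -/
theorem integral_estimates_testPair {d : ℕ} {Ω : Set (E d)} {T : ℝ} (hT : 0 < T)
    {M K : H10 Ω →ₗ[ℝ] H10 Ω →ₗ[ℝ] ℝ} (hM : ∀ u v, M u v = M v u) (hM0 : ∀ u, 0 ≤ M u u)
    (hMdef : ∀ u, M u u = 0 → u = 0) (hK : ∀ u v, K u v = K v u) (hK0 : ∀ u, 0 ≤ K u u)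
    (hKdef : ∀ u, K u u = 0 → u = 0) {k : ℝ} (hk : 0 < k) (hMK : ∀ u, M u u ≤ k * K u u)
    {Sx : Submodule ℝ (H10 Ω)} {N : H10 Ω →ₗ[ℝ] H10 Ω} (hNS : ∀ u, N u ∈ Sx)
    (hKN : ∀ u, ∀ v ∈ Sx, K (N u) v = M u v) {St : Submodule ℝ (ℝ → ℝ)}
    (hSt : ∀ w ∈ St, MemH1zero T w) {U V U' V' l χ : ℝ → H10 Ω} (hU : U ∈ tensor Sx St)
    (hV : V ∈ tensor Sx St) (hU' : U' ∈ tensor Sx (timeDeriv St))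
    (hV' : V' ∈ tensor Sx (timeDeriv St))
    (hUcoer : ∫ t, K (U t) (U t) ∂expMeasure T ≤ 2 * T * ∫ t, K (U t) (U' t) ∂expMeasure T)
    (hVcoer : ∫ t, M (V t) (V t) ∂expMeasure T ≤ 2 * T * ∫ t, M (V t) (V' t) ∂expMeasure T)
    (hne : ¬ (U =ᵐ[volume.restrict (Ioo 0 T)] 0 ∧ V =ᵐ[volume.restrict (Ioo 0 T)] 0))
    (hldef : l = fun t => (2 * T) • U' t + N (V' t))
    (hχdef : χ = fun t => (2 * T) • V' t - U' t) :
    ∃ D P : ℝ, 0 ≤ D ∧ 0 < P ∧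
      (∫ t, M (U' t) (U' t) ∂expMeasure T) + (∫ t, K (N (V' t)) (N (V' t)) ∂expMeasure T)
        + (∫ t, K (U t) (U t) ∂expMeasure T) + (∫ t, M (V t) (V t) ∂expMeasure T) = D + P ∧
      (D + P) / 2 ≤ (∫ t, M (V' t) (l t) ∂expMeasure T) + (∫ t, K (U t) (l t) ∂expMeasure T)
        - (∫ t, M (U' t) (χ t) ∂expMeasure T) + (∫ t, M (V t) (χ t) ∂expMeasure T) ∧
      0 < (∫ t, M (l t) (l t) ∂expMeasure T) + (∫ t, K (N (χ t)) (N (χ t)) ∂expMeasure T) ∧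
      (∫ t, M (l t) (l t) ∂expMeasure T) + (∫ t, K (N (χ t)) (N (χ t)) ∂expMeasure T)
        ≤ (k + 4 * T ^ 2) * D := by
  have hL : ∀ w ∈ St, MemLp w 2 (volume.restrict (Ioo 0 T)) := fun w hw => (hSt w hw).memLp hT
  have hL' : ∀ w ∈ timeDeriv St, MemLp w 2 (volume.restrict (Ioo 0 T)) := fun w hw =>
    memLp_of_mem_timeDeriv hSt hw
  have hNV : (fun t => N (V' t)) ∈ tensor Sx (timeDeriv St) := map_mem_tensor N hNS hV'
  have hl : l ∈ tensor Sx (timeDeriv St) := by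
    rw [hldef]
    exact Submodule.add_mem _ (Submodule.smul_mem _ _ hU') hNV
  have hχ : χ ∈ tensor Sx (timeDeriv St) := by
    rw [hχdef]
    exact Submodule.sub_mem _ (Submodule.smul_mem _ _ hV') hU'
  have hNχ : (fun t => N (χ t)) ∈ tensor Sx (timeDeriv St) := map_mem_tensor N hNS hχ
  set ν := expMeasure T
  -- `D` collects the time derivatives in the trial norm, `P` the remaining terms.
  set D := ∫ t, (M (U' t) (U' t) + K (N (V' t)) (N (V' t))) ∂ν with hD
  set P := ∫ t, (K (U t) (U t) + M (V t) (V t)) ∂ν with hP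
  have iUU := integrable_bilin_of_mem_tensor hT K hL hL hU hU
  have iVV := integrable_bilin_of_mem_tensor hT M hL hL hV hV
  have iU'U' := integrable_bilin_of_mem_tensor hT M hL' hL' hU' hU'
  have iNVNV := integrable_bilin_of_mem_tensor hT K hL' hL' hNV hNV
  have iV'l := integrable_bilin_of_mem_tensor hT M hL' hL' hV' hl
  have iUl := integrable_bilin_of_mem_tensor hT K hL hL' hU hl
  have iU'χ := integrable_bilin_of_mem_tensor hT M hL' hL' hU' hχ
  have iVχ := integrable_bilin_of_mem_tensor hT M hL hL' hV hχ
  have iUU' := integrable_bilin_of_mem_tensor hT K hL hL' hU hU'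
  have iVV' := integrable_bilin_of_mem_tensor hT M hL hL' hV hV'
  have ill := integrable_bilin_of_mem_tensor hT M hL' hL' hl hl
  have iχχ := integrable_bilin_of_mem_tensor hT K hL' hL' hNχ hNχ
  have hP0 : 0 < P := by
    refine lt_of_le_of_ne (integral_nonneg fun t => add_nonneg (hK0 _) (hM0 _)) fun h => hne ?_
    have hae := (integral_eq_zero_iff_of_nonneg
      (fun t => add_nonneg (hK0 (U t)) (hM0 (V t))) (iUU.add iVV)).1 h.symm
    constructor
    · refine ae_expMeasure_iff.1 ?_
      filter_upwards [hae] with t ht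
      exact hKdef _ ((add_eq_zero_iff_of_nonneg (hK0 _) (hM0 _)).1 ht).1
    · refine ae_expMeasure_iff.1 ?_
      filter_upwards [hae] with t ht
      exact hMdef _ ((add_eq_zero_iff_of_nonneg (hK0 _) (hM0 _)).1 ht).2
  have hD0 : 0 ≤ D := integral_nonneg fun t => add_nonneg (hM0 _) (hK0 _)
  have iD : Integrable (fun t => M (U' t) (U' t) + K (N (V' t)) (N (V' t))) ν := iU'U'.add iNVNV
  have iP : Integrable (fun t => K (U t) (U t) + M (V t) (V t)) ν := iUU.add iVV
  have iA : Integrable (fun t => M (V' t) (l t) + K (U t) (l t)) ν := iV'l.add iUl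
  have iB : Integrable (fun t => M (V' t) (l t) + K (U t) (l t) - M (U' t) (χ t)) ν := iA.sub iU'χ
  have iF : Integrable (fun t => 2 * T * K (U t) (U' t) + 2 * T * M (V t) (V' t)) ν :=
    (iUU'.const_mul _).add (iVV'.const_mul _)
  have iG : Integrable (fun t => 2 * T * K (U t) (U' t) + 2 * T * M (V t) (V' t)
      + (M (U' t) (U' t) + K (N (V' t)) (N (V' t))) / 2) ν := iF.add (iD.div_const 2)
  have hform : (D + P) / 2
      ≤ ∫ t, (M (V' t) (l t) + K (U t) (l t) - M (U' t) (χ t) + M (V t) (χ t)) ∂ν := by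
    have h : ∫ t, (2 * T * K (U t) (U' t) + 2 * T * M (V t) (V' t)
        + (M (U' t) (U' t) + K (N (V' t)) (N (V' t))) / 2 - (K (U t) (U t) + M (V t) (V t)) / 2) ∂ν
        ≤ ∫ t, (M (V' t) (l t) + K (U t) (l t) - M (U' t) (χ t) + M (V t) (χ t)) ∂ν := by
      refine integral_mono (iG.sub (iP.div_const 2)) (iB.add iVχ) fun t => ?_
      rw [hldef, hχdef]
      exact le_form_testPair hM hM0 hK hK0 hNS hKN (2 * T) (U t) (U' t) (V t) (V' t)
    rw [integral_sub iG (iP.div_const 2), integral_add iF (iD.div_const 2),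
      integral_add (iUU'.const_mul _) (iVV'.const_mul _), integral_div, integral_div,
      integral_const_mul, integral_const_mul] at h
    have h3 : P = (∫ t, K (U t) (U t) ∂ν) + ∫ t, M (V t) (V t) ∂ν := integral_add iUU iVV
    refine le_trans ?_ h
    linarith
  have hWle : ∫ t, (M (l t) (l t) + K (N (χ t)) (N (χ t))) ∂ν
      ≤ (k + 4 * T ^ 2) * D := by
    rw [hD, ← integral_const_mul]
    refine integral_mono (ill.add iχχ) ((iU'U'.add iNVNV).const_mul _) fun t => ?_
    rw [hldef, hχdef]
    refine (testPair_norm_sq_le hM hM0 hK hk hMK hNS hKN (2 * T) (U' t) (V' t)).trans_eq ?_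
    ring
  -- If the test norm vanished, so would the form, against its lower bound.
  have hWpos : 0 < ∫ t, (M (l t) (l t) + K (N (χ t)) (N (χ t))) ∂ν := by
    refine lt_of_le_of_ne (integral_nonneg fun t => add_nonneg (hM0 _) (hK0 _)) fun h => ?_
    have hae := (integral_eq_zero_iff_of_nonneg
      (fun t => add_nonneg (hM0 (l t)) (hK0 (N (χ t)))) (ill.add iχχ)).1 h.symm
    have hz : ∫ t, (M (V' t) (l t) + K (U t) (l t) - M (U' t) (χ t) + M (V t) (χ t)) ∂ν = 0 := by
      refine integral_eq_zero_of_ae ?_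
      filter_upwards [hae] with t ht
      have h0 := (add_eq_zero_iff_of_nonneg (hM0 _) (hK0 _)).1 ht
      have hl0 : l t = 0 := hMdef _ h0.1
      have hχ0 : ∀ v ∈ Sx, M v (χ t) = 0 := fun v hv => by
        rw [hM, ← hKN _ v hv, hKdef _ h0.2, map_zero, LinearMap.zero_apply]
      rw [hl0, hχ0 _ (mem_of_mem_tensor hU' t), hχ0 _ (mem_of_mem_tensor hV t)]
      simp
    linarith
  have hsum : (∫ t, M (V' t) (l t) ∂ν) + (∫ t, K (U t) (l t) ∂ν) - (∫ t, M (U' t) (χ t) ∂ν)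
      + (∫ t, M (V t) (χ t) ∂ν)
      = ∫ t, (M (V' t) (l t) + K (U t) (l t) - M (U' t) (χ t) + M (V t) (χ t)) ∂ν := by
    rw [integral_add iB iVχ, integral_sub iA iU'χ, integral_add iV'l iUl]
  refine ⟨D, P, hD0, hP0, ?_, ?_, ?_, ?_⟩
  · rw [hD, hP, integral_add iU'U' iNVNV, integral_add iUU iVV]
    ring
  · rwa [hsum]
  · rwa [← integral_add ill iχχ]
  · rwa [← integral_add ill iχχ]

/-! ### The weighted norms as integrals of bilinear forms -/

theorem massₗ_self {d : ℕ} {Ω : Set (E d)} (u : H10 Ω) : massₗ Ω u u = ‖fn u‖ ^ 2 :=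
  real_inner_self_eq_norm_sq (fn u)

theorem massₗ_self_nonneg {d : ℕ} {Ω : Set (E d)} (u : H10 Ω) : 0 ≤ massₗ Ω u u :=
  real_inner_self_nonneg (x := fn u)

theorem massₗ_comm {d : ℕ} {Ω : Set (E d)} (u v : H10 Ω) : massₗ Ω u v = massₗ Ω v u :=
  real_inner_comm (fn v) (fn u)

theorem innerE_eq_integral {d : ℕ} {Ω : Set (E d)} {T : ℝ} (hT : 0 < T) (F G : ℝ → H10 Ω) :
    innerE T F G = ∫ t, massₗ Ω (F t) (G t) ∂expMeasure T :=
  weighted_eq_integral hT _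

theorem energyE_eq_integral {d : ℕ} {Ω : Set (E d)} {T : ℝ} (hT : 0 < T) {c : E d → ℝ}
    (hc : MemLp c ⊤ (volume.restrict Ω)) (F G : ℝ → H10 Ω) :
    energyE T c F G = ∫ t, energyₗ hc (F t) (G t) ∂expMeasure T :=
  weighted_eq_integral hT _

theorem innerE_congr_left {d : ℕ} {Ω : Set (E d)} {T : ℝ} (hT : 0 < T) {F F' : ℝ → H10 Ω}
    (G : ℝ → H10 Ω) (h : ∀ᵐ t ∂expMeasure T, F t = F' t) : innerE T F G = innerE T F' G := by
  rw [innerE_eq_integral hT, innerE_eq_integral hT]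
  refine integral_congr_ae ?_
  filter_upwards [h] with t ht
  rw [ht]

theorem innerE_congr_right {d : ℕ} {Ω : Set (E d)} {T : ℝ} (hT : 0 < T) (F : ℝ → H10 Ω)
    {G G' : ℝ → H10 Ω} (h : ∀ᵐ t ∂expMeasure T, G t = G' t) : innerE T F G = innerE T F G' := by
  rw [innerE_eq_integral hT, innerE_eq_integral hT]
  refine integral_congr_ae ?_
  filter_upwards [h] with t ht
  rw [ht]

theorem newtonSqE_eq_integral {d : ℕ} {Ω : Set (E d)} {T : ℝ} (hT : 0 < T) {c : E d → ℝ}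
    (hc : MemLp c ⊤ (volume.restrict Ω)) {Sx : Submodule ℝ (H10 Ω)} {N : H10 Ω →ₗ[ℝ] H10 Ω}
    (hN : ∀ u, N u = discreteNewton c Sx (fn u)) {F F' : ℝ → H10 Ω}
    (h : ∀ᵐ t ∂expMeasure T, F t = F' t) :
    newtonSqE T c Sx F = ∫ t, energyₗ hc (N (F' t)) (N (F' t)) ∂expMeasure T := by
  rw [newtonSqE, weighted_eq_integral hT]
  refine integral_congr_ae ?_
  filter_upwards [h] with t ht
  rw [energyₗ_apply, hN, ht]

end WaveInfSup

end

/-! ### The inf-sup inequality -/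

set_option maxHeartbeats 1000000 in
open WaveInfSup in
theorem mainTheorem3 {d : ℕ} (hd : 1 ≤ d) (Ω : Set (WaveInfSup.E d)) (hΩ : IsOpen Ω)
    (hΩb : Bornology.IsBounded Ω) (T : ℝ) (hT : 0 < T) (c : WaveInfSup.E d → ℝ) (c₀ : ℝ)
    (hc₀ : 0 < c₀) (hc : MemLp c ⊤ (volume.restrict Ω))
    (hcc₀ : ∀ᵐ x ∂(volume.restrict Ω), c₀ ≤ c x) :
    (∃ C : ℝ, WaveInfSup.IsPoincareConstant Ω C) ∧
    ∀ C : ℝ, WaveInfSup.IsPoincareConstant Ω C →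
    ∀ (Sx : Submodule ℝ (WaveInfSup.H10 Ω)) (St : Submodule ℝ (ℝ → ℝ)),
      FiniteDimensional ℝ Sx → FiniteDimensional ℝ St →
      (∀ w ∈ St, WaveInfSup.MemH1zero T w) →
    ∀ U ∈ WaveInfSup.tensor Sx St, ∀ V ∈ WaveInfSup.tensor Sx St,
      ¬ (U =ᵐ[volume.restrict (Ioo 0 T)] 0 ∧ V =ᵐ[volume.restrict (Ioo 0 T)] 0) →
    ∃ l ∈ WaveInfSup.tensor Sx (WaveInfSup.timeDeriv St),
    ∃ χ ∈ WaveInfSup.tensor Sx (WaveInfSup.timeDeriv St),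
      0 < WaveInfSup.normV T c Sx U V ∧ 0 < WaveInfSup.normW T c Sx l χ ∧
      1 / (2 * Real.sqrt (C ^ 2 / c₀ ^ 2 + 4 * T ^ 2)) ≤
        WaveInfSup.formA T c U V l χ /
          (WaveInfSup.normV T c Sx U V * WaveInfSup.normW T c Sx l χ) := by
  refine ⟨exists_isPoincareConstant hd hΩ hΩb, ?_⟩
  intro C hC Sx St _ _ hSt U hU V hV hne
  obtain ⟨N, hNeq, hNS, hN⟩ := exists_discreteNewton_linearMap hΩ hc₀ hc hcc₀ hC Sx
  obtain ⟨U', hU', hdU, hUcoer⟩ := exists_timeDeriv hT hSt hU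
  obtain ⟨V', hV', hdV, hVcoer⟩ := exists_timeDeriv hT hSt hV
  have hMK : ∀ u, massₗ Ω u u ≤ C ^ 2 / c₀ ^ 2 * energyₗ hc u u := fun u => by
    rw [massₗ_self]
    exact norm_fn_sq_le_energy hc₀ hc hcc₀ hC u
  have hMdef : ∀ u, massₗ Ω u u = 0 → u = 0 := fun u hu => by
    rw [massₗ_self] at hu
    exact eq_zero_of_fn_eq_zero hΩ (norm_eq_zero.1 (pow_eq_zero_iff two_ne_zero |>.1 hu))
  have hKdef : ∀ u, energyₗ hc u u = 0 → u = 0 := fun u hu =>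
    eq_zero_of_energy_eq_zero hΩ hc₀ hc hcc₀ hC hu
  have hk : 0 < C ^ 2 / c₀ ^ 2 := div_pos (pow_pos hC.1 2) (pow_pos hc₀ 2)
  have hl := Submodule.add_mem _ (Submodule.smul_mem _ (2 * T) hU') (map_mem_tensor N hNS hV')
  have hχ := Submodule.sub_mem _ (Submodule.smul_mem _ (2 * T) hV') hU'
  obtain ⟨D, P, hD0, hP0, hDP, hform, hWpos, hWle⟩ := integral_estimates_testPair hT massₗ_comm
    massₗ_self_nonneg hMdef (energy_comm c) (energy_self_nonneg c) hKdef hk hMK hNS hN hSt hU hV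
    hU' hV' (hUcoer _ (energy_comm c) (energy_self_nonneg c))
    (hVcoer _ massₗ_comm massₗ_self_nonneg) hne rfl rfl
  refine ⟨_, hl, _, hχ, ?_⟩
  set l : ℝ → H10 Ω := fun t => (2 * T) • U' t + N (V' t)
  set χ : ℝ → H10 Ω := fun t => (2 * T) • V' t - U' t
  change 0 < normV T c Sx U V ∧ 0 < normW T c Sx l χ ∧ _ ≤ formA T c U V l χ
    / (normV T c Sx U V * normW T c Sx l χ)
  have hnormV : normV T c Sx U V = Real.sqrt (D + P) := by
    rw [normV, innerE_congr_left hT _ hdU, innerE_congr_right hT _ hdU,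
      newtonSqE_eq_integral hT hc hNeq hdV, innerE_eq_integral hT, innerE_eq_integral hT,
      energyE_eq_integral hT hc, ← hDP]
  have hnormW : normW T c Sx l χ = Real.sqrt ((∫ t, massₗ Ω (l t) (l t) ∂expMeasure T)
      + ∫ t, energyₗ hc (N (χ t)) (N (χ t)) ∂expMeasure T) := by
    rw [normW, innerE_eq_integral hT, newtonSqE_eq_integral hT hc hNeq (.of_forall fun _ => rfl)]
  have hformA : (D + P) / 2 ≤ formA T c U V l χ := by
    rw [formA, innerE_congr_left hT _ hdV, innerE_congr_left hT _ hdU, innerE_eq_integral hT,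
      innerE_eq_integral hT, innerE_eq_integral hT, energyE_eq_integral hT hc]
    exact hform
  have hVpos : 0 < normV T c Sx U V := by
    rw [hnormV]
    exact Real.sqrt_pos.2 (by linarith)
  have hWpos' : 0 < normW T c Sx l χ := by
    rw [hnormW]
    exact Real.sqrt_pos.2 hWpos
  refine ⟨hVpos, hWpos', ?_⟩
  have hr : 0 < C ^ 2 / c₀ ^ 2 + 4 * T ^ 2 := by positivity
  have hWV : normW T c Sx l χ
      ≤ Real.sqrt (C ^ 2 / c₀ ^ 2 + 4 * T ^ 2) * normV T c Sx U V := by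
    rw [hnormW, hnormV, ← Real.sqrt_mul hr.le]
    exact Real.sqrt_le_sqrt (hWle.trans (mul_le_mul_of_nonneg_left (by linarith) hr.le))
  have hVsq : normV T c Sx U V ^ 2 = D + P := by
    rw [hnormV, Real.sq_sqrt (by linarith)]
  have hsq := Real.sqrt_pos.2 hr
  rw [div_le_div_iff₀ (by positivity) (mul_pos hVpos hWpos'), one_mul]
  calc normV T c Sx U V * normW T c Sx l χ
      ≤ normV T c Sx U V * (Real.sqrt (C ^ 2 / c₀ ^ 2 + 4 * T ^ 2) * normV T c Sx U V) :=
        mul_le_mul_of_nonneg_left hWV hVpos.le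
    _ = (D + P) / 2 * (2 * Real.sqrt (C ^ 2 / c₀ ^ 2 + 4 * T ^ 2)) := by
        rw [← hVsq]
        ring
    _ ≤ formA T c U V l χ * (2 * Real.sqrt (C ^ 2 / c₀ ^ 2 + 4 * T ^ 2)) :=
        mul_le_mul_of_nonneg_right hformA (by positivity)
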